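/- Let $\mathbb{B}_n=\{z\in\mathbb{C}^n:\|z\|<1\}$ be the Euclidean unit ball, with Bergman metric $$H_z(u,\bar u)=\frac{(1-\|z\|^2)\|u\|^2+|\langle u,z\rangle|^2}{(1-\|z\|^2)^2}\qquad(z\in\mathbb{B}_n,\ u\in\mathbb{C}^n),$$ normalized so that for $n=1$ it is $|u|^2/(1-|z|^2)^2$ (that is, $\tfrac1{n+1}$ times the complex Hessian of the logarithm of the Bergman kernel on the diagonal). For $f$ holomorphic on $\mathbb{B}_n$ put $$Q_f(z)=\sup_{u\in\mathbb{C}^n\setminus\{0\}}\frac{\bigl|\sum_{j=1}^n\frac{\partial f}{\partial z_j}(z)u_j\bigr|}{H_z(u,\bar u)^{1/2}},\qquad \beta_f=\sup_{z\in\mathbb{B}_n}Q_f(z).$$ The Bloch space $\mathcal{B}(\mathbb{B}_n)$ is the space of holomorphic $f:\mathbb{B}_n\to\mathbb{C}$ with $\beta_f<\infty$, normed by $\|f\|_{\mathcal B}=|f(0)|+\beta_f$; the little Bloch space $\mathcal{B}_0(\mathbb{B}_n)$ is the subspace of those $f\in\mathcal{B}(\mathbb{B}_n)$ with $\lim_{\|z\|\to1^-}Q_f(z)=0$.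 For $\psi$ holomorphic on $\mathbb{B}_n$ let $M_\psi f=\psi f$; $M_\psi$ is bounded on one of these spaces $X$ if $M_\psi X\subseteq X$ and there is a constant $C$ with $\|M_\psi f\|_{\mathcal B}\le C\|f\|_{\mathcal B}$ for all $f\in X$. Let $\psi$ be holomorphic on $\mathbb{B}_n$. Then the following are equivalent: (a) $M_\psi$ is bounded on $\mathcal{B}(\mathbb{B}_n)$; (b) $M_\psi$ is bounded on $\mathcal{B}_0(\mathbb{B}_n)$; (c) $\psi$ is bounded on $\mathbb{B}_n$ and $\displaystyle\sup_{z\in\mathbb{B}_n}\log\frac{1+\|z\|}{1-\|z\|}\,Q_\psi(z)<\infty$. -/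

import Mathlib

open Set Filter Topology

noncomputable section

namespace BlochBall

/-- Complex Euclidean space `ℂⁿ`, with its Hermitian inner product and Euclidean norm. -/
abbrev Cn (n : ℕ) : Type := EuclideanSpace ℂ (Fin n)

/-- The open unit ball of `ℂⁿ`. -/
def unitBall (n : ℕ) : Set (Cn n) := Metric.ball 0 1

/-- The quadratic form `H_z(u, ū)` of the Bergman metric of the unit ball at `z`,
`((1 - ‖z‖²) ‖u‖² + |⟨u, z⟩|²) / (1 - ‖z‖²)²`, which is `1 / (n + 1)` times the complex Hessian of
the logarithm of the Bergman kernel `z ↦ (n! / πⁿ) (1 - ‖z‖²) ^ (-(n + 1))`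
(see `bergmanForm_eq_complexHessian`). The scaling is the one for which `n = 1` gives
`|u|² / (1 - |z|²)²`, hence `Q_f(z) = (1 - |z|²) |f'(z)|` on the disk, and for which the Bergman
distance from `0` to `z` is `(1/2) log ((1 + ‖z‖) / (1 - ‖z‖))`. -/
def bergmanForm {n : ℕ} (z u : Cn n) : ℝ :=
  ((1 - ‖z‖ ^ 2) * ‖u‖ ^ 2 + ‖inner ℂ z u‖ ^ 2) / (1 - ‖z‖ ^ 2) ^ 2

/-- `∑ⱼₖ ∂²g/∂zⱼ∂z̄ₖ (z) uⱼ ūₖ`, that is, `∂²/∂s∂s̄ = (1/4) (∂²/∂x² + ∂²/∂y²)` of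
`s = x + i y ↦ g (z + s u)` at `s = 0`. -/
def complexHessian {n : ℕ} (g : Cn n → ℝ) (z u : Cn n) : ℝ :=
  (1 / 4) * (deriv (deriv fun x : ℝ => g (z + (x : ℂ) • u)) 0 +
    deriv (deriv fun y : ℝ => g (z + ((y : ℂ) * Complex.I) • u)) 0)

/-- The Bergman kernel of the unit ball on the diagonal (Lebesgue measure on `ℂⁿ`). -/
def bergmanKernelDiag {n : ℕ} (z : Cn n) : ℝ :=
  (n.factorial / Real.pi ^ n) * ((1 - ‖z‖ ^ 2) ^ (n + 1))⁻¹

theorem deriv_deriv_log_quadratic (c m a b d : ℝ) (ha : 0 < a) :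
    deriv (deriv fun t : ℝ => c - m * Real.log (a - b * t - d * t ^ 2)) 0 =
      m * (2 * d / a + b ^ 2 / a ^ 2) := by
  have hq : ∀ t : ℝ, HasDerivAt (fun t : ℝ => a - b * t - d * t ^ 2) (-b - 2 * d * t) t := by
    intro t
    have h := (((hasDerivAt_id t).const_mul b).const_sub a).sub
      (((hasDerivAt_id t).pow 2).const_mul d)
    refine h.congr_deriv ?_
    simp
    ring
  have hpos : ∀ᶠ t : ℝ in 𝓝 0, a - b * t - d * t ^ 2 ≠ 0 := by
    have hc : ContinuousAt (fun t : ℝ => a - b * t - d * t ^ 2) 0 := (hq 0).continuousAt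
    apply hc.eventually_ne
    simpa using ha.ne'
  have hd : (deriv fun t : ℝ => c - m * Real.log (a - b * t - d * t ^ 2)) =ᶠ[𝓝 0]
      fun t => -(m * ((-b - 2 * d * t) / (a - b * t - d * t ^ 2))) := by
    filter_upwards [hpos] with t ht
    exact ((((hq t).log ht).const_mul m).const_sub c).deriv
  rw [hd.deriv_eq]
  have hn : HasDerivAt (fun t : ℝ => -b - 2 * d * t) (-(2 * d)) 0 := by
    have h := ((hasDerivAt_id (0 : ℝ)).const_mul (2 * d)).const_sub (-b)
    simpa using h
  have h := (((hn.div (hq 0) (by simpa using ha.ne')).const_mul m).neg).deriv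
  refine h.trans ?_
  have ha' := ha.ne'
  simp only [mul_zero, sub_zero, ne_eq, OfNat.ofNat_ne_zero, not_false_eq_true, zero_pow]
  field_simp
  ring

/-- The form above is the Bergman metric, up to the factor `1 / (n + 1)`. -/
theorem bergmanForm_eq_complexHessian {n : ℕ} (z u : Cn n) (hz : z ∈ unitBall n) :
    bergmanForm z u =
      (1 / ((n : ℝ) + 1)) * complexHessian (fun w => Real.log (bergmanKernelDiag w)) z u := by
  have hz1 : ‖z‖ < 1 := by simpa [unitBall] using hz
  have ha : 0 < 1 - ‖z‖ ^ 2 := by nlinarith [norm_nonneg z]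
  have hC : (n.factorial / Real.pi ^ n : ℝ) ≠ 0 := by positivity
  have hlog : ∀ w : Cn n, 1 - ‖w‖ ^ 2 ≠ 0 → Real.log (bergmanKernelDiag w) =
      Real.log (n.factorial / Real.pi ^ n) - ((n : ℝ) + 1) * Real.log (1 - ‖w‖ ^ 2) := by
    intro w hw
    rw [bergmanKernelDiag, Real.log_mul hC (inv_ne_zero (pow_ne_zero _ hw)), Real.log_inv,
      Real.log_pow]
    push_cast
    ring
  have hnorm : ∀ s : ℂ, 1 - ‖z + s • u‖ ^ 2 =
      1 - ‖z‖ ^ 2 - 2 * (s * inner ℂ z u).re - ‖s‖ ^ 2 * ‖u‖ ^ 2 := by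
    intro s
    rw [@norm_add_sq ℂ, inner_smul_right, norm_smul]
    simp [mul_pow]
    ring
  have key : ∀ s : ℝ → ℂ, Continuous s → s 0 = 0 →
      (fun t : ℝ => Real.log (bergmanKernelDiag (z + s t • u))) =ᶠ[𝓝 0] fun t : ℝ =>
        Real.log (n.factorial / Real.pi ^ n) - ((n : ℝ) + 1) *
          Real.log (1 - ‖z‖ ^ 2 - 2 * (s t * inner ℂ z u).re - ‖s t‖ ^ 2 * ‖u‖ ^ 2) := by
    intro s hs h0
    have hc : Continuous fun t : ℝ => 1 - ‖z + s t • u‖ ^ 2 := by fun_prop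
    have : ∀ᶠ t : ℝ in 𝓝 0, 1 - ‖z + s t • u‖ ^ 2 ≠ 0 := by
      apply hc.continuousAt.eventually_ne
      simpa [h0] using ha.ne'
    filter_upwards [this] with t ht
    rw [hlog _ ht, hnorm]
  have h1 := (key (fun x => (x : ℂ)) (by fun_prop) (by simp)).deriv.deriv_eq
  have h2 := (key (fun y => (y : ℂ) * Complex.I) (by fun_prop) (by simp)).deriv.deriv_eq
  have e1 := deriv_deriv_log_quadratic (Real.log (n.factorial / Real.pi ^ n)) ((n : ℝ) + 1)
    (1 - ‖z‖ ^ 2) (2 * (inner ℂ z u).re) (‖u‖ ^ 2) ha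
  have e2 := deriv_deriv_log_quadratic (Real.log (n.factorial / Real.pi ^ n)) ((n : ℝ) + 1)
    (1 - ‖z‖ ^ 2) (-2 * (inner ℂ z u).im) (‖u‖ ^ 2) ha
  have f1 : (fun t : ℝ => Real.log (n.factorial / Real.pi ^ n) - ((n : ℝ) + 1) *
      Real.log (1 - ‖z‖ ^ 2 - 2 * ((t : ℂ) * inner ℂ z u).re - ‖(t : ℂ)‖ ^ 2 * ‖u‖ ^ 2)) =
      fun t : ℝ => Real.log (n.factorial / Real.pi ^ n) - ((n : ℝ) + 1) *
      Real.log (1 - ‖z‖ ^ 2 - 2 * (inner ℂ z u).re * t - ‖u‖ ^ 2 * t ^ 2) := by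
    funext t
    congr 3
    simp
    ring
  have f2 : (fun t : ℝ => Real.log (n.factorial / Real.pi ^ n) - ((n : ℝ) + 1) *
      Real.log (1 - ‖z‖ ^ 2 - 2 * ((t : ℂ) * Complex.I * inner ℂ z u).re -
        ‖(t : ℂ) * Complex.I‖ ^ 2 * ‖u‖ ^ 2)) =
      fun t : ℝ => Real.log (n.factorial / Real.pi ^ n) - ((n : ℝ) + 1) *
      Real.log (1 - ‖z‖ ^ 2 - -2 * (inner ℂ z u).im * t - ‖u‖ ^ 2 * t ^ 2) := by
    funext t
    congr 3
    simp
    ring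
  have hin : ‖inner ℂ z u‖ ^ 2 = (inner ℂ z u).re ^ 2 + (inner ℂ z u).im ^ 2 := by
    rw [← Complex.normSq_eq_norm_sq, Complex.normSq_apply]
    ring
  rw [complexHessian, h1, h2, f1, f2, e1, e2, bergmanForm, hin]
  have hn : ((n : ℝ) + 1) ≠ 0 := by positivity
  field_simp
  ring

/-- `Q_f(z) = sup_{u ≠ 0} |∇f(z) u| / H_z(u, ū)^{1/2}`, where
`∇f(z) u = ∑ⱼ ∂f/∂zⱼ(z) uⱼ` is the complex derivative of `f` at `z` applied to `u`. -/
def Q {n : ℕ} (f : Cn n → ℂ) (z : Cn n) : ℝ :=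
  ⨆ u : {u : Cn n // u ≠ 0}, ‖fderiv ℂ f z u‖ / Real.sqrt (bergmanForm z u)

/-- `f` is holomorphic on the unit ball (values of `f` off the ball are irrelevant). -/
def IsHolo {n : ℕ} (f : Cn n → ℂ) : Prop := DifferentiableOn ℂ f (unitBall n)

/-- `β_f = sup_{z ∈ 𝔹ₙ} Q_f(z)`. -/
def blochSeminorm {n : ℕ} (f : Cn n → ℂ) : ℝ := ⨆ z : unitBall n, Q f z

/-- The Bloch norm `|f(0)| + β_f`. -/
def blochNorm {n : ℕ} (f : Cn n → ℂ) : ℝ := ‖f 0‖ + blochSeminorm f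

/-- The Bloch space of the unit ball: `f` holomorphic with `sup_{z ∈ 𝔹ₙ} Q_f(z) < ∞`. -/
def blochSpace (n : ℕ) : Set (Cn n → ℂ) :=
  {f | IsHolo f ∧ BddAbove (range fun z : unitBall n => Q f z)}

/-- The little Bloch space of the unit ball: `f` Bloch with `Q_f(z) → 0` as `‖z‖ → 1⁻`. -/
def littleBlochSpace (n : ℕ) : Set (Cn n → ℂ) :=
  {f | f ∈ blochSpace n ∧ Tendsto (Q f) (comap (fun z : Cn n => ‖z‖) (𝓝[<] 1)) (𝓝 0)}

/-- The multiplication operator `M_ψ f = ψ f`. -/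
def mulOp {n : ℕ} (ψ f : Cn n → ℂ) : Cn n → ℂ := fun z => ψ z * f z

/-- `M_ψ` is a bounded operator on the space `X` of functions on the ball, normed by the Bloch
norm: it maps `X` into itself and `‖M_ψ f‖ ≤ C ‖f‖` for some constant `C` and all `f ∈ X`. -/
def MulOpBoundedOn {n : ℕ} (ψ : Cn n → ℂ) (X : Set (Cn n → ℂ)) : Prop :=
  (∀ f ∈ X, mulOp ψ f ∈ X) ∧ ∃ C : ℝ, ∀ f ∈ X, blochNorm (mulOp ψ f) ≤ C * blochNorm f

/-- `ψ ∈ H^∞(𝔹ₙ)`. -/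
def IsHInfty {n : ℕ} (ψ : Cn n → ℂ) : Prop :=
  IsHolo ψ ∧ ∃ C : ℝ, ∀ z ∈ unitBall n, ‖ψ z‖ ≤ C

end BlochBall

end

namespace BlochBall

variable {n : ℕ}

/-! By the Leibniz rule, `Q (mulOp ψ f)` and `‖f‖ * Q ψ` differ by at most `‖ψ‖ * Q f`. For bounded
`ψ` the question is therefore how large a Bloch function can be at `z`. Upper bound: integrating
along the radius, `‖f z‖` grows at most like the Bergman distance `logRatio ‖z‖ / 2`
(`norm_le_blochNorm_mul`), and is `o(logRatio ‖z‖)` for little Bloch functions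
(`exists_norm_le_add_mul_logRatio`). Hence (c) gives (a) and (b). Lower bound: the functions `log (1
- ⟨z, w⟩)` lie in the little Bloch space with norms bounded uniformly in `w` (`Q_logKernel_le`), and
reach the size `logRatio ‖w‖` at `z = w` up to an additive constant. Testing `M_ψ` on them gives the
weighted bound on `Q ψ`; boundedness of `ψ` comes from the iterates `M_ψ ^ k 1 = ψ ^ k`. -/

theorem mem_unitBall {z : Cn n} : z ∈ unitBall n ↔ ‖z‖ < 1 := by simp [unitBall]

theorem one_sub_norm_sq_pos {z : Cn n} (hz : z ∈ unitBall n) : 0 < 1 - ‖z‖ ^ 2 := by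
  have := mem_unitBall.1 hz
  nlinarith [norm_nonneg z]

theorem IsHolo.differentiableAt {f : Cn n → ℂ} (hf : IsHolo f) {z : Cn n} (hz : z ∈ unitBall n) :
    DifferentiableAt ℂ f z :=
  DifferentiableOn.differentiableAt hf (Metric.isOpen_ball.mem_nhds hz)

theorem IsHolo.mulOp {ψ f : Cn n → ℂ} (hψ : IsHolo ψ) (hf : IsHolo f) : IsHolo (mulOp ψ f) :=
  DifferentiableOn.mul hψ hf

/-! ### Estimates for the Bergman metric. -/

theorem sqrt_bergmanForm {z : Cn n} (hz : z ∈ unitBall n) (u : Cn n) :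
    √(bergmanForm z u) =
      √((1 - ‖z‖ ^ 2) * ‖u‖ ^ 2 + ‖inner ℂ z u‖ ^ 2) / (1 - ‖z‖ ^ 2) := by
  have h := one_sub_norm_sq_pos hz
  rw [bergmanForm, Real.sqrt_div (by positivity), Real.sqrt_sq h.le]

/-- The Bergman metric dominates `‖u‖² / (1 - ‖z‖²)`. -/
theorem norm_le_sqrt_mul_sqrt_bergmanForm {z : Cn n} (hz : z ∈ unitBall n) (u : Cn n) :
    ‖u‖ ≤ √(1 - ‖z‖ ^ 2) * √(bergmanForm z u) := by
  have h := one_sub_norm_sq_pos hz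
  rw [← Real.sqrt_mul h.le]
  apply Real.le_sqrt_of_sq_le
  rw [bergmanForm, mul_div_assoc', le_div_iff₀ (by positivity)]
  nlinarith [mul_nonneg h.le (sq_nonneg ‖(inner ℂ z u : ℂ)‖)]

theorem norm_le_sqrt_bergmanForm {z : Cn n} (hz : z ∈ unitBall n) (u : Cn n) :
    ‖u‖ ≤ √(bergmanForm z u) := by
  refine (norm_le_sqrt_mul_sqrt_bergmanForm hz u).trans
    (mul_le_of_le_one_left (Real.sqrt_nonneg _) ?_)
  rw [Real.sqrt_le_iff]
  refine ⟨zero_le_one, ?_⟩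
  nlinarith [sq_nonneg ‖z‖]

/-- In the radial direction the two terms of the numerator add up to exactly `‖z‖ ^ 2`. The
resulting speed of `t ↦ t • z` is the derivative of `logRatio (t * ‖z‖) / 2`. -/
theorem sqrt_bergmanForm_smul_self (z : Cn n) (t : ℝ) (h : (t • z : Cn n) ∈ unitBall n) :
    √(bergmanForm (t • z) z) = ‖z‖ / (1 - (t * ‖z‖) ^ 2) := by
  have h1 : ‖t • z‖ ^ 2 = (t * ‖z‖) ^ 2 := by
    rw [norm_smul, mul_pow, mul_pow, Real.norm_eq_abs, sq_abs]
  have h2 : ‖(inner ℂ (t • z) z : ℂ)‖ ^ 2 = t ^ 2 * ‖z‖ ^ 4 := by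
    rw [RCLike.real_smul_eq_coe_smul (K := ℂ), inner_smul_left, norm_mul, inner_self_eq_norm_sq_to_K, mul_pow]
    simp [← pow_mul]
  rw [sqrt_bergmanForm h, h1, h2]
  congr 1
  rw [← Real.sqrt_sq (norm_nonneg z)]
  congr 1
  rw [Real.sqrt_sq (norm_nonneg z)]
  ring

/-! ### Calculus of `Q` and of the Bloch norm. -/

theorem Q_nonneg (f : Cn n → ℂ) (z : Cn n) : 0 ≤ Q f z :=
  Real.iSup_nonneg fun _ => by positivity

theorem Q_le {f : Cn n → ℂ} {z : Cn n} {M : ℝ} (hM : 0 ≤ M)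
    (h : ∀ u, ‖fderiv ℂ f z u‖ ≤ M * √(bergmanForm z u)) : Q f z ≤ M := by
  refine Real.iSup_le (fun u => ?_) hM
  exact div_le_of_le_mul₀ (Real.sqrt_nonneg _) hM (h u)

theorem norm_fderiv_le_Q_mul {f : Cn n → ℂ} {z : Cn n} (hz : z ∈ unitBall n) (u : Cn n) :
    ‖fderiv ℂ f z u‖ ≤ Q f z * √(bergmanForm z u) := by
  by_cases hu : u = 0
  · simpa [hu] using mul_nonneg (Q_nonneg f z) (Real.sqrt_nonneg _)
  have hpos : 0 < √(bergmanForm z u) := (norm_pos_iff.2 hu).trans_le (norm_le_sqrt_bergmanForm hz u)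
  rw [← div_le_iff₀ hpos]
  -- A real supremum defaults to `0` when unbounded, so a bound is needed: the operator norm works
  -- since the metric dominates the Euclidean norm.
  refine le_ciSup (f := fun u : {u : Cn n // u ≠ 0} =>
    ‖fderiv ℂ f z u‖ / √(bergmanForm z u)) ⟨‖fderiv ℂ f z‖, ?_⟩ ⟨u, hu⟩
  rintro _ ⟨v, rfl⟩
  refine div_le_of_le_mul₀ (Real.sqrt_nonneg _) (norm_nonneg _) ?_
  exact ((fderiv ℂ f z).le_opNorm v).trans
    (mul_le_mul_of_nonneg_left (norm_le_sqrt_bergmanForm hz _) (norm_nonneg _))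

theorem fderiv_mulOp_apply {ψ f : Cn n → ℂ} (hψ : IsHolo ψ) (hf : IsHolo f) {z : Cn n}
    (hz : z ∈ unitBall n) (u : Cn n) :
    fderiv ℂ (mulOp ψ f) z u = ψ z * fderiv ℂ f z u + f z * fderiv ℂ ψ z u := by
  have := ((hψ.differentiableAt hz).hasFDerivAt.mul (hf.differentiableAt hz).hasFDerivAt).fderiv
  change fderiv ℂ (mulOp ψ f) z = _ at this
  simp [this]

theorem Q_mulOp_le {ψ f : Cn n → ℂ} (hψ : IsHolo ψ) (hf : IsHolo f) {z : Cn n}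
    (hz : z ∈ unitBall n) : Q (mulOp ψ f) z ≤ ‖ψ z‖ * Q f z + ‖f z‖ * Q ψ z := by
  have h1 := Q_nonneg f z
  have h2 := Q_nonneg ψ z
  refine Q_le (by positivity) fun u => ?_
  rw [fderiv_mulOp_apply hψ hf hz, add_mul, mul_assoc, mul_assoc]
  refine (norm_add_le _ _).trans ?_
  rw [norm_mul, norm_mul]
  gcongr <;> exact norm_fderiv_le_Q_mul hz u

/-- The Leibniz rule solved for the term `f z * ∇ψ`; this is the form used for necessity. -/
theorem norm_mul_Q_le {ψ f : Cn n → ℂ} (hψ : IsHolo ψ) (hf : IsHolo f) {z : Cn n}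
    (hz : z ∈ unitBall n) : ‖f z‖ * Q ψ z ≤ Q (mulOp ψ f) z + ‖ψ z‖ * Q f z := by
  have h1 := Q_nonneg f z
  have h2 := Q_nonneg (mulOp ψ f) z
  rcases eq_or_ne (f z) 0 with h0 | h0
  · simp only [h0, norm_zero, zero_mul]
    positivity
  rw [mul_comm, ← le_div_iff₀ (norm_pos_iff.2 h0)]
  refine Q_le (by positivity) fun u => ?_
  rw [div_mul_eq_mul_div, le_div_iff₀ (norm_pos_iff.2 h0), ← norm_mul]
  have : fderiv ℂ ψ z u * f z = fderiv ℂ (mulOp ψ f) z u - ψ z * fderiv ℂ f z u := by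
    rw [fderiv_mulOp_apply hψ hf hz]
    ring
  rw [this, add_mul, mul_assoc]
  refine (norm_sub_le _ _).trans ?_
  rw [norm_mul]
  gcongr <;> exact norm_fderiv_le_Q_mul hz u

theorem Q_le_blochSeminorm {f : Cn n → ℂ} (hf : f ∈ blochSpace n) {z : Cn n}
    (hz : z ∈ unitBall n) : Q f z ≤ blochSeminorm f :=
  le_ciSup (f := fun z : unitBall n => Q f z) hf.2 ⟨z, hz⟩

theorem blochSeminorm_nonneg (f : Cn n → ℂ) : 0 ≤ blochSeminorm f :=
  Real.iSup_nonneg fun _ => Q_nonneg _ _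

theorem blochSeminorm_le {f : Cn n → ℂ} {M : ℝ} (hM : 0 ≤ M) (h : ∀ z ∈ unitBall n, Q f z ≤ M) :
    blochSeminorm f ≤ M :=
  Real.iSup_le (fun z => h z z.2) hM

theorem mem_blochSpace {f : Cn n → ℂ} (hf : IsHolo f) {M : ℝ} (h : ∀ z ∈ unitBall n, Q f z ≤ M) :
    f ∈ blochSpace n :=
  ⟨hf, M, by rintro _ ⟨z, rfl⟩; exact h z z.2⟩

theorem blochNorm_nonneg (f : Cn n → ℂ) : 0 ≤ blochNorm f :=
  add_nonneg (norm_nonneg _) (blochSeminorm_nonneg f)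

theorem blochSeminorm_le_blochNorm (f : Cn n → ℂ) : blochSeminorm f ≤ blochNorm f :=
  le_add_of_nonneg_left (norm_nonneg _)

/-! ### Growth of Bloch functions along radii. -/

/-- Twice the Bergman distance from the origin to a point of norm `x`. -/
noncomputable def logRatio (x : ℝ) : ℝ := Real.log ((1 + x) / (1 - x))

theorem logRatio_zero : logRatio 0 = 0 := by simp [logRatio]

theorem logRatio_nonneg {x : ℝ} (h0 : 0 ≤ x) (h1 : x < 1) : 0 ≤ logRatio x := by
  refine Real.log_nonneg ?_
  rw [le_div_iff₀ (by linarith)]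
  linarith

theorem hasDerivAt_logRatio {x : ℝ} (h0 : -1 < x) (h1 : x < 1) :
    HasDerivAt logRatio (2 / (1 - x ^ 2)) x := by
  have ha : 1 + x ≠ 0 := by linarith
  have hb : 1 - x ≠ 0 := by linarith
  have hc : 1 - x ^ 2 ≠ 0 := by
    rw [show 1 - x ^ 2 = (1 + x) * (1 - x) by ring]
    exact mul_ne_zero ha hb
  have h := (((hasDerivAt_id x).const_add 1).div ((hasDerivAt_id x).const_sub 1) hb).log
    (div_ne_zero ha hb)
  refine h.congr_deriv ?_
  simp only [id, Pi.div_apply]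
  field_simp
  ring

theorem tendsto_logRatio : Tendsto logRatio (𝓝[<] 1) atTop := by
  refine Real.tendsto_log_atTop.comp ?_
  have h1 : Tendsto (fun x : ℝ => 1 + x) (𝓝[<] 1) (𝓝 2) := by
    have : Continuous fun x : ℝ => 1 + x := by fun_prop
    exact tendsto_nhdsWithin_of_tendsto_nhds (by simpa [one_add_one_eq_two] using this.tendsto 1)
  have h2 : Tendsto (fun x : ℝ => 1 - x) (𝓝[<] 1) (𝓝[>] 0) := by
    refine tendsto_nhdsWithin_iff.2 ⟨?_, ?_⟩
    · have : Continuous fun x : ℝ => 1 - x := by fun_prop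
      exact tendsto_nhdsWithin_of_tendsto_nhds (by simpa using this.tendsto 1)
    · filter_upwards [self_mem_nhdsWithin] with x hx
      exact sub_pos.2 (mem_Iio.1 hx)
  simpa [div_eq_mul_inv] using h1.pos_mul_atTop two_pos h2.inv_tendsto_nhdsGT_zero

/-- A bound for `Q f` on a radial segment bounds the increment of `f` by Bergman distance. -/
theorem norm_sub_le_of_Q_le {f : Cn n → ℂ} (hf : IsHolo f) {z : Cn n} (hz : z ∈ unitBall n)
    {a M : ℝ} (ha0 : 0 ≤ a) (ha1 : a ≤ 1) (h : ∀ t ∈ Icc a 1, Q f (t • z) ≤ M) :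
    ‖f z - f (a • z)‖ ≤ M / 2 * (logRatio ‖z‖ - logRatio (a * ‖z‖)) := by
  have hz1 := mem_unitBall.1 hz
  have hlt : ∀ t ∈ Icc a 1, 0 ≤ t * ‖z‖ ∧ t * ‖z‖ < 1 := fun t ht => by
    have h0 : 0 ≤ t := ha0.trans ht.1
    exact ⟨by positivity, (mul_le_of_le_one_left (norm_nonneg z) ht.2).trans_lt hz1⟩
  have hmem : ∀ t ∈ Icc a 1, t • z ∈ unitBall n := fun t ht => by
    rw [mem_unitBall, norm_smul, Real.norm_of_nonneg (ha0.trans ht.1)]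
    exact (hlt t ht).2
  have hd : ∀ t ∈ Icc a 1, HasDerivAt (fun t : ℝ => f (t • z) - f (a • z))
      (fderiv ℂ f (t • z) z) t := fun t ht => by
    have h1 : HasFDerivAt f ((fderiv ℂ f (t • z)).restrictScalars ℝ) (t • z) :=
      (hf.differentiableAt (hmem t ht)).hasFDerivAt.restrictScalars ℝ
    have h2 : HasDerivAt (fun t : ℝ => t • z) z t := by
      simpa using (hasDerivAt_id t).smul_const z
    simpa using (h1.comp_hasDerivAt t h2).sub_const (f (a • z))
  have hB : ∀ t ∈ Icc a 1, HasDerivAt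
      (fun t : ℝ => M / 2 * (logRatio (t * ‖z‖) - logRatio (a * ‖z‖)))
      (M * (‖z‖ / (1 - (t * ‖z‖) ^ 2))) t := fun t ht => by
    have h1 := hasDerivAt_logRatio (by linarith [hlt t ht]) (hlt t ht).2
    have h2 : HasDerivAt (fun t : ℝ => t * ‖z‖) ‖z‖ t := by
      simpa using (hasDerivAt_id t).mul_const ‖z‖
    refine (((h1.comp t h2).sub_const (logRatio (a * ‖z‖))).const_mul (M / 2)).congr_deriv ?_
    ring
  -- Mean value inequality against a real majorant: the majorant's derivative is `M` times the
  -- radial Bergman speed.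
  have key := image_norm_le_of_norm_deriv_right_le_deriv_boundary'
    (fun t ht => (hd t ht).continuousAt.continuousWithinAt)
    (fun t ht => (hd t (Ico_subset_Icc_self ht)).hasDerivWithinAt) (by simp)
    (fun t ht => (hB t ht).continuousAt.continuousWithinAt)
    (fun t ht => (hB t (Ico_subset_Icc_self ht)).hasDerivWithinAt)
    (fun t ht => ?_) (right_mem_Icc.2 ha1)
  · simpa using key
  · have ht' := Ico_subset_Icc_self ht
    rw [← sqrt_bergmanForm_smul_self z t (hmem t ht')]
    exact (norm_fderiv_le_Q_mul (hmem t ht') z).trans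
      (mul_le_mul_of_nonneg_right (h t ht') (Real.sqrt_nonneg _))

theorem smul_mem_unitBall {z : Cn n} (hz : z ∈ unitBall n) {t : ℝ} (h0 : 0 ≤ t) (h1 : t ≤ 1) :
    t • z ∈ unitBall n := by
  rw [mem_unitBall, norm_smul, Real.norm_of_nonneg h0]
  exact (mul_le_of_le_one_left (norm_nonneg z) h1).trans_lt (mem_unitBall.1 hz)

theorem norm_le_of_mem_blochSpace {f : Cn n → ℂ} (hf : f ∈ blochSpace n) {z : Cn n}
    (hz : z ∈ unitBall n) : ‖f z‖ ≤ ‖f 0‖ + blochSeminorm f / 2 * logRatio ‖z‖ := by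
  have h := norm_sub_le_of_Q_le hf.1 hz le_rfl zero_le_one
    (fun t ht => Q_le_blochSeminorm hf (smul_mem_unitBall hz ht.1 ht.2))
  simp only [zero_smul, zero_mul, logRatio_zero, sub_zero] at h
  have := norm_le_norm_add_norm_sub' (f z) (f 0)
  linarith

theorem norm_le_blochNorm_mul {f : Cn n → ℂ} (hf : f ∈ blochSpace n) {z : Cn n}
    (hz : z ∈ unitBall n) : ‖f z‖ ≤ (1 + logRatio ‖z‖) * blochNorm f := by
  have h := norm_le_of_mem_blochSpace hf hz
  have hL := logRatio_nonneg (norm_nonneg z) (mem_unitBall.1 hz)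
  have := mul_nonneg hL (norm_nonneg (f 0))
  have := mul_nonneg hL (blochSeminorm_nonneg f)
  have := blochSeminorm_nonneg f
  rw [blochNorm]
  linarith

/-- Functions of the little Bloch space are `o(log (1 / (1 - ‖z‖)))`. -/
theorem exists_norm_le_add_mul_logRatio {f : Cn n → ℂ} (hf : f ∈ littleBlochSpace n) {ε : ℝ}
    (hε : 0 < ε) :
    ∃ C, 0 ≤ C ∧ ∃ r < 1, ∀ z ∈ unitBall n, r < ‖z‖ → ‖f z‖ ≤ C + ε * logRatio ‖z‖ := by
  have hev := hf.2.eventually (gt_mem_nhds hε)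
  rw [eventually_comap] at hev
  obtain ⟨r₀, hr₀, hr⟩ := (mem_nhdsLT_iff_exists_Ioo_subset (a := (1 : ℝ))).1 hev
  -- The radius is cut at `r`: the general growth bound is used up to norm `r`, and beyond it `Q f <
  -- ε` gives the small slope.
  obtain ⟨r, hr1, hr2⟩ := exists_between (max_lt hr₀ one_pos : max r₀ 0 < 1)
  have hr0 : 0 < r := (le_max_right _ _).trans_lt hr1
  have hrr : r₀ < r := (le_max_left _ _).trans_lt hr1
  have hLr := logRatio_nonneg hr0.le hr2
  have hβ := blochSeminorm_nonneg f
  refine ⟨‖f 0‖ + blochSeminorm f / 2 * logRatio r, by positivity, r, hr2, fun z hz hrz => ?_⟩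
  have hz0 : 0 < ‖z‖ := hr0.trans hrz
  have hz1 := mem_unitBall.1 hz
  have ha1 : r / ‖z‖ ≤ 1 := (div_le_one hz0).2 hrz.le
  have ha0 : 0 ≤ r / ‖z‖ := by positivity
  have hrad : r / ‖z‖ * ‖z‖ = r := div_mul_cancel₀ _ hz0.ne'
  have h := norm_sub_le_of_Q_le hf.1.1 hz ha0 ha1 (M := ε) fun t ht => by
    have ht0 : 0 ≤ t := ha0.trans ht.1
    have hnorm : ‖t • z‖ = t * ‖z‖ := by rw [norm_smul, Real.norm_of_nonneg ht0]
    refine (hr (?_ : t * ‖z‖ ∈ Ioo r₀ 1) (t • z) hnorm).le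
    refine ⟨hrr.trans_le ?_, (mul_le_of_le_one_left (norm_nonneg z) ht.2).trans_lt hz1⟩
    rw [← hrad]
    gcongr
    exact ht.1
  have h2 := norm_le_of_mem_blochSpace hf.1 (smul_mem_unitBall hz ha0 ha1)
  have hnr : ‖(r / ‖z‖) • z‖ = r := by rw [norm_smul, Real.norm_of_nonneg ha0, hrad]
  rw [hnr] at h2
  rw [hrad] at h
  have h3 := norm_le_norm_add_norm_sub' (f z) (f ((r / ‖z‖) • z))
  have := mul_nonneg hε.le (logRatio_nonneg hz0.le hz1)
  have := mul_nonneg hε.le hLr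
  linarith

/-! ### Sufficiency of condition (c). -/

/-- Cauchy's estimate on the complex line `s ↦ z + s • u`: the disc of radius `1 / (4 * ‖u‖)` stays
within norm `3 / 4`. -/
theorem Q_le_of_norm_le {f : Cn n → ℂ} (hf : IsHolo f) {C : ℝ}
    (h : ∀ z ∈ unitBall n, ‖f z‖ ≤ C) {z : Cn n} (hz : ‖z‖ ≤ 1 / 2) : Q f z ≤ 4 * C := by
  have hzb : z ∈ unitBall n := mem_unitBall.2 (by linarith)
  have hC : 0 ≤ C := (norm_nonneg _).trans (h z hzb)
  refine Q_le (by positivity) fun u => ?_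
  refine le_trans ?_ (mul_le_mul_of_nonneg_left (norm_le_sqrt_bergmanForm hzb u) (by positivity))
  rcases eq_or_ne u 0 with rfl | hu
  · simp
  have hu' : 0 < ‖u‖ := norm_pos_iff.2 hu
  have hR : 0 < 1 / (4 * ‖u‖) := by positivity
  have hmem : ∀ s ∈ Metric.closedBall (0 : ℂ) (1 / (4 * ‖u‖)), z + s • u ∈ unitBall n := by
    intro s hs
    rw [mem_unitBall]
    have hs' : ‖s‖ * ‖u‖ ≤ 1 / 4 := by
      have := mul_le_mul_of_nonneg_right (mem_closedBall_zero_iff.1 hs) hu'.le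
      refine this.trans_eq ?_
      field_simp
    calc ‖z + s • u‖ ≤ ‖z‖ + ‖s‖ * ‖u‖ := (norm_add_le _ _).trans_eq (by rw [norm_smul])
      _ < 1 := by linarith
  have hd : ∀ s ∈ Metric.closedBall (0 : ℂ) (1 / (4 * ‖u‖)),
      HasDerivAt (fun s : ℂ => f (z + s • u)) (fderiv ℂ f (z + s • u) u) s := fun s hs => by
    have h2 : HasDerivAt (fun s : ℂ => z + s • u) u s := by
      simpa using ((hasDerivAt_id s).smul_const u).const_add z
    exact (hf.differentiableAt (hmem s hs)).hasFDerivAt.comp_hasDerivAt s h2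
  have key := Complex.norm_deriv_le_of_forall_mem_sphere_norm_le hR
    (f := fun s : ℂ => f (z + s • u)) (c := 0) (C := C)
    (DifferentiableOn.diffContOnCl_ball
      (fun s hs => (hd s hs).differentiableAt.differentiableWithinAt) subset_rfl)
    (fun s hs => h _ (hmem s (Metric.sphere_subset_closedBall hs)))
  rw [(hd 0 (by simp)).deriv] at key
  simp only [zero_smul, add_zero] at key
  refine key.trans_eq ?_
  field_simp

theorem one_le_logRatio {x : ℝ} (h0 : 1 / 2 ≤ x) (h1 : x < 1) : 1 ≤ logRatio x := by
  rw [logRatio, Real.le_log_iff_exp_le (by apply div_pos <;> linarith), le_div_iff₀ (by linarith)]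
  have := Real.exp_one_lt_d9
  nlinarith

/-- The logarithmic weight vanishes at the origin, so near it the boundedness of `ψ` has to control
`Q ψ`; for `‖z‖ ≥ 1 / 2` the weight is at least `1`. -/
theorem exists_Q_le {ψ : Cn n → ℂ} (hψ : IsHInfty ψ) {K : ℝ}
    (hK : ∀ z ∈ unitBall n, logRatio ‖z‖ * Q ψ z ≤ K) : ∃ C, ∀ z ∈ unitBall n, Q ψ z ≤ C := by
  obtain ⟨C, hC⟩ := hψ.2
  refine ⟨max (4 * C) K, fun z hz => ?_⟩
  rcases le_total ‖z‖ (1 / 2) with h | h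
  · exact (Q_le_of_norm_le hψ.1 hC h).trans (le_max_left _ _)
  · refine le_trans ?_ ((hK z hz).trans (le_max_right _ _))
    exact le_mul_of_one_le_left (Q_nonneg _ _) (one_le_logRatio h (mem_unitBall.1 hz))

theorem exists_mulOp_bound {ψ : Cn n → ℂ} (hψ : IsHInfty ψ) {K : ℝ}
    (hK : ∀ z ∈ unitBall n, logRatio ‖z‖ * Q ψ z ≤ K) :
    ∃ C, ∀ f ∈ blochSpace n, mulOp ψ f ∈ blochSpace n ∧
      blochNorm (mulOp ψ f) ≤ C * blochNorm f := by
  obtain ⟨A, hA⟩ := hψ.2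
  obtain ⟨B, hB⟩ := exists_Q_le hψ hK
  have h0 : (0 : Cn n) ∈ unitBall n := mem_unitBall.2 (by simp)
  have hA0 : 0 ≤ A := (norm_nonneg _).trans (hA 0 h0)
  have hB0 : 0 ≤ B := (Q_nonneg _ _).trans (hB 0 h0)
  have hK0 : 0 ≤ K := by simpa [logRatio_zero] using hK 0 h0
  -- One `A` pays for the value at `0`; the seminorm costs `A` for `ψ ∇f` and `B + K` for `f ∇ψ`,
  -- matching the growth factor `1 + logRatio ‖z‖`.
  refine ⟨2 * A + B + K, fun f hf => ?_⟩
  have hN := blochNorm_nonneg f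
  have hQ : ∀ z ∈ unitBall n, Q (mulOp ψ f) z ≤ (A + B + K) * blochNorm f := fun z hz => by
    have h1 : ‖ψ z‖ * Q f z ≤ A * blochNorm f :=
      mul_le_mul (hA z hz) ((Q_le_blochSeminorm hf hz).trans (blochSeminorm_le_blochNorm f))
        (Q_nonneg _ _) hA0
    have h2 : ‖f z‖ * Q ψ z ≤ (B + K) * blochNorm f := by
      have h3 := mul_le_mul_of_nonneg_right (norm_le_blochNorm_mul hf hz) (Q_nonneg ψ z)
      have h4 := mul_le_mul_of_nonneg_right (add_le_add (hB z hz) (hK z hz)) hN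
      linarith
    have := Q_mulOp_le hψ.1 hf.1 hz
    linarith
  refine ⟨mem_blochSpace (hψ.1.mulOp hf.1) hQ, ?_⟩
  have h5 : ‖mulOp ψ f 0‖ ≤ A * blochNorm f := by
    rw [mulOp, norm_mul]
    exact mul_le_mul (hA 0 h0) (le_add_of_nonneg_right (blochSeminorm_nonneg f))
      (norm_nonneg _) hA0
  have h6 := blochSeminorm_le (by positivity) hQ
  rw [blochNorm]
  linarith

theorem eventually_mem_unitBall :
    ∀ᶠ z : Cn n in comap (fun z : Cn n => ‖z‖) (𝓝[<] 1), z ∈ unitBall n := by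
  filter_upwards [preimage_mem_comap self_mem_nhdsWithin] with z hz
  exact mem_unitBall.2 hz

theorem mulOp_mem_littleBlochSpace {ψ : Cn n → ℂ} (hψ : IsHInfty ψ) {K : ℝ}
    (hK : ∀ z ∈ unitBall n, logRatio ‖z‖ * Q ψ z ≤ K) {f : Cn n → ℂ}
    (hf : f ∈ littleBlochSpace n) : mulOp ψ f ∈ littleBlochSpace n := by
  obtain ⟨D, hD⟩ := exists_mulOp_bound hψ hK
  refine ⟨(hD f hf.1).1, ?_⟩
  obtain ⟨A, hA⟩ := hψ.2
  have h0 : (0 : Cn n) ∈ unitBall n := mem_unitBall.2 (by simp)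
  have hK0 : 0 ≤ K := by simpa [logRatio_zero] using hK 0 h0
  have hL : Tendsto (fun z : Cn n => logRatio ‖z‖) (comap (fun z : Cn n => ‖z‖) (𝓝[<] 1)) atTop :=
    tendsto_logRatio.comp tendsto_comap
  have hψ0 : Tendsto (Q ψ) (comap (fun z : Cn n => ‖z‖) (𝓝[<] 1)) (𝓝 0) := by
    refine squeeze_zero' (Eventually.of_forall fun z => Q_nonneg ψ z) ?_
      (hL.const_div_atTop K)
    filter_upwards [eventually_mem_unitBall, hL.eventually_gt_atTop 0] with z hz hz'
    rw [le_div_iff₀ hz', mul_comm]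
    exact hK z hz
  have hfψ : Tendsto (fun z => ‖f z‖ * Q ψ z) (comap (fun z : Cn n => ‖z‖) (𝓝[<] 1)) (𝓝 0) := by
    refine tendsto_order.2 ⟨fun a ha => Eventually.of_forall fun z =>
      ha.trans_le (mul_nonneg (norm_nonneg _) (Q_nonneg _ _)), fun ε hε => ?_⟩
    -- The logarithmic part of the growth of `f` then contributes at most `ε / 2`, while the
    -- constant part is killed by `Q ψ → 0`. The `+ 1` covers `K = 0`.
    obtain ⟨C, hC, r, hr, hrC⟩ := exists_norm_le_add_mul_logRatio hf
      (show 0 < ε / (2 * (K + 1)) by positivity)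
    have hC' : Tendsto (fun z => C * Q ψ z) (comap (fun z : Cn n => ‖z‖) (𝓝[<] 1)) (𝓝 0) := by
      simpa using hψ0.const_mul C
    filter_upwards [eventually_mem_unitBall, hC'.eventually (gt_mem_nhds (half_pos hε)),
      preimage_mem_comap (Ioo_mem_nhdsLT hr)] with z hz hz1 hz2
    have h1 := mul_le_mul_of_nonneg_right (hrC z hz hz2.1) (Q_nonneg ψ z)
    have h2 : ε / (2 * (K + 1)) * (logRatio ‖z‖ * Q ψ z) ≤ ε / 2 := by
      calc _ ≤ ε / (2 * (K + 1)) * (K + 1) := by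
            gcongr
            linarith [hK z hz]
        _ = ε / 2 := by field_simp
    linarith
  have hψf : Tendsto (fun z => A * Q f z) (comap (fun z : Cn n => ‖z‖) (𝓝[<] 1)) (𝓝 0) := by
    simpa using hf.2.const_mul A
  refine squeeze_zero' (Eventually.of_forall fun z => Q_nonneg _ z) ?_
    (by simpa using hψf.add hfψ)
  filter_upwards [eventually_mem_unitBall] with z hz
  exact (Q_mulOp_le hψ.1 hf.1.1 hz).trans
    (add_le_add_left (mul_le_mul_of_nonneg_right (hA z hz) (Q_nonneg f z)) _)

/-! ### Logarithmic test functions. -/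

/-- The test function `z ↦ log (1 - ⟨z, w⟩)`. -/
noncomputable def logKernel (w z : Cn n) : ℂ := Complex.log (1 - inner ℂ w z)

theorem norm_inner_lt_one {w z : Cn n} (hw : w ∈ unitBall n) (hz : z ∈ unitBall n) :
    ‖(inner ℂ w z : ℂ)‖ < 1 :=
  (norm_inner_le_norm w z).trans_lt
    (mul_lt_one_of_nonneg_of_lt_one_left (norm_nonneg _) (mem_unitBall.1 hw) (mem_unitBall.1 hz).le)

theorem hasFDerivAt_logKernel {w z : Cn n} (hw : w ∈ unitBall n) (hz : z ∈ unitBall n) :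
    HasFDerivAt (logKernel w) ((1 - inner ℂ w z : ℂ)⁻¹ • -innerSL ℂ w) z := by
  refine HasFDerivAt.clog ?_ ?_
  · simpa using ((innerSL ℂ w).hasFDerivAt (x := z)).const_sub 1
  · left
    have := (Complex.re_le_norm (inner ℂ w z)).trans_lt (norm_inner_lt_one hw hz)
    simpa using this

theorem norm_fderiv_logKernel {w z : Cn n} (hw : w ∈ unitBall n) (hz : z ∈ unitBall n)
    (u : Cn n) : ‖fderiv ℂ (logKernel w) z u‖ = ‖(inner ℂ w u : ℂ)‖ / ‖(1 - inner ℂ w z : ℂ)‖ := by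
  rw [(hasFDerivAt_logKernel hw hz).fderiv]
  simp [div_eq_inv_mul]

theorem isHolo_logKernel {w : Cn n} (hw : w ∈ unitBall n) : IsHolo (logKernel w) :=
  fun _ hz => (hasFDerivAt_logKernel hw hz).differentiableAt.differentiableWithinAt

/-- Expand the square and use `‖w‖, ‖z‖ < 1`: what remains is `2 * Re (1 - ⟨z, w⟩)`. -/
theorem norm_sub_sq_le {w z : Cn n} (hw : w ∈ unitBall n) (hz : z ∈ unitBall n) :
    ‖w - z‖ ^ 2 ≤ 2 * ‖(1 - inner ℂ w z : ℂ)‖ := by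
  have h1 := mem_unitBall.1 hw
  have h2 := mem_unitBall.1 hz
  have h3 := Complex.re_le_norm (1 - inner ℂ w z)
  rw [@norm_sub_sq ℂ]
  simp only [Complex.sub_re, Complex.one_re, RCLike.re_eq_complex_re] at h3 ⊢
  nlinarith [norm_nonneg w, norm_nonneg z]

theorem one_sub_norm_sq_le {w z : Cn n} (hw : w ∈ unitBall n) (hz : z ∈ unitBall n) :
    1 - ‖z‖ ^ 2 ≤ 2 * ‖(1 - inner ℂ w z : ℂ)‖ := by
  have h1 := mem_unitBall.1 hw
  have h2 := mem_unitBall.1 hz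
  have h3 := norm_sub_norm_le (1 : ℂ) (inner ℂ w z)
  have h4 := norm_inner_le_norm (𝕜 := ℂ) w z
  rw [norm_one] at h3
  nlinarith [norm_nonneg w, norm_nonneg z]

/-- The point is uniformity in `w`. Split `⟨u, w⟩ = ⟨u, w - z⟩ + ⟨u, z⟩`. With `A = 1 - ‖z‖ ^ 2` and
`D = ‖1 - ⟨z, w⟩‖`, both `A` and `‖w - z‖ ^ 2` are at most `2 * D`, so each summand contributes `2`
to the bound. -/
theorem Q_logKernel_le {w z : Cn n} (hw : w ∈ unitBall n) (hz : z ∈ unitBall n) :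
    Q (logKernel w) z ≤ 4 := by
  refine Q_le (by norm_num) fun u => ?_
  have hA := one_sub_norm_sq_pos hz
  have h1 := norm_sub_sq_le hw hz
  have h2 := one_sub_norm_sq_le hw hz
  have hD : 0 < ‖(1 - inner ℂ w z : ℂ)‖ := by linarith
  rw [norm_fderiv_logKernel hw hz, sqrt_bergmanForm hz, div_le_iff₀ hD]
  set A := 1 - ‖z‖ ^ 2
  set D := ‖(1 - inner ℂ w z : ℂ)‖
  set S := √(A * ‖u‖ ^ 2 + ‖(inner ℂ z u : ℂ)‖ ^ 2)
  have hS1 : √A * ‖u‖ ≤ S := by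
    refine Real.le_sqrt_of_sq_le ?_
    rw [mul_pow, Real.sq_sqrt hA.le]
    linarith [sq_nonneg ‖(inner ℂ z u : ℂ)‖]
  have hS2 : ‖(inner ℂ z u : ℂ)‖ ≤ S := Real.le_sqrt_of_sq_le (by nlinarith [sq_nonneg ‖u‖])
  have h3 : ‖(inner ℂ w u : ℂ)‖ ≤ ‖w - z‖ * ‖u‖ + ‖(inner ℂ z u : ℂ)‖ := by
    have : (inner ℂ w u : ℂ) = inner ℂ (w - z) u + inner ℂ z u := by rw [inner_sub_left]; ring
    rw [this]
    exact (norm_add_le _ _).trans (add_le_add_left (norm_inner_le_norm _ _) _)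
  have h4 : √A * ‖w - z‖ ≤ 2 * D := by
    refine abs_le_of_sq_le_sq' ?_ (by positivity) |>.2
    rw [mul_pow, Real.sq_sqrt hA.le, sq (2 * D)]
    exact mul_le_mul h2 h1 (sq_nonneg _) (by positivity)
  have h5 : A * (‖w - z‖ * ‖u‖) ≤ 2 * D * S := by
    calc A * (‖w - z‖ * ‖u‖) = (√A * ‖w - z‖) * (√A * ‖u‖) := by
          nth_rewrite 1 [← Real.mul_self_sqrt hA.le]
          ring
      _ ≤ 2 * D * S := mul_le_mul h4 hS1 (by positivity) (by positivity)
  have h6 : A * ‖(inner ℂ z u : ℂ)‖ ≤ 2 * D * S :=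
    mul_le_mul h2 hS2 (norm_nonneg _) (by positivity)
  have h7 := mul_le_mul_of_nonneg_left h3 hA.le
  rw [mul_div_assoc', div_mul_eq_mul_div, le_div_iff₀ hA]
  linarith

/-- For fixed `w` the gradient is bounded by `1 / (1 - ‖w‖)`, and measuring it in the Bergman metric
gains the factor `√(1 - ‖z‖ ^ 2)`, which tends to `0`. -/
theorem logKernel_mem_littleBlochSpace {w : Cn n} (hw : w ∈ unitBall n) :
    logKernel w ∈ littleBlochSpace n := by
  refine ⟨mem_blochSpace (isHolo_logKernel hw) fun z hz => Q_logKernel_le hw hz, ?_⟩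
  have hw1 : 0 < 1 - ‖w‖ := sub_pos.2 (mem_unitBall.1 hw)
  have hlim : Tendsto (fun z : Cn n => (1 - ‖w‖)⁻¹ * √(1 - ‖z‖ ^ 2))
      (comap (fun z : Cn n => ‖z‖) (𝓝[<] 1)) (𝓝 0) := by
    have hc : Continuous fun x : ℝ => (1 - ‖w‖)⁻¹ * √(1 - x ^ 2) := by fun_prop
    have : Tendsto (fun x : ℝ => (1 - ‖w‖)⁻¹ * √(1 - x ^ 2)) (𝓝[<] 1) (𝓝 0) :=
      tendsto_nhdsWithin_of_tendsto_nhds (by simpa using hc.tendsto 1)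
    exact this.comp tendsto_comap
  refine squeeze_zero' (Eventually.of_forall fun z => Q_nonneg _ z) ?_ hlim
  filter_upwards [eventually_mem_unitBall] with z hz
  refine Q_le (by positivity) fun u => ?_
  rw [norm_fderiv_logKernel hw hz, div_eq_inv_mul, mul_assoc]
  have h1 : 1 - ‖w‖ ≤ ‖(1 - inner ℂ w z : ℂ)‖ := by
    have h3 := norm_sub_norm_le (1 : ℂ) (inner ℂ w z)
    have h4 := norm_inner_le_norm (𝕜 := ℂ) w z
    rw [norm_one] at h3
    nlinarith [norm_nonneg w, mem_unitBall.1 hz]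
  have h2 : ‖(inner ℂ w u : ℂ)‖ ≤ √(1 - ‖z‖ ^ 2) * √(bergmanForm z u) :=
    ((norm_inner_le_norm w u).trans (mul_le_of_le_one_left (norm_nonneg u)
      (mem_unitBall.1 hw).le)).trans (norm_le_sqrt_mul_sqrt_bergmanForm hz u)
  gcongr

theorem blochNorm_logKernel_le {w : Cn n} (hw : w ∈ unitBall n) : blochNorm (logKernel w) ≤ 4 := by
  have h := blochSeminorm_le (by norm_num) fun z hz => Q_logKernel_le hw hz
  simpa [blochNorm, logKernel] using h

/-- Writing `(1 + x) / (1 - x) = (1 + x) ^ 2 / (1 - x ^ 2)`, the numerator costs at most `log 4`. -/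
theorem logRatio_le_norm_logKernel {w : Cn n} (hw : w ∈ unitBall n) :
    logRatio ‖w‖ ≤ 2 * Real.log 2 + ‖logKernel w w‖ := by
  have hA := one_sub_norm_sq_pos hw
  have hw1 := mem_unitBall.1 hw
  have hw0 := norm_nonneg w
  have h1 : logKernel w w = (Real.log (1 - ‖w‖ ^ 2) : ℝ) := by
    rw [logKernel, inner_self_eq_norm_sq_to_K, Complex.ofReal_log hA.le]
    simp
  have h2 : (1 + ‖w‖) / (1 - ‖w‖) = (1 + ‖w‖) ^ 2 / (1 - ‖w‖ ^ 2) := by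
    have : 1 - ‖w‖ ≠ 0 := by linarith
    rw [div_eq_div_iff this hA.ne']
    ring
  have h3 : Real.log (1 + ‖w‖) ≤ Real.log 2 := Real.log_le_log (by linarith) (by linarith)
  have h4 := neg_le_abs (Real.log (1 - ‖w‖ ^ 2))
  rw [logRatio, h2, Real.log_div (by positivity) hA.ne', Real.log_pow, h1, Complex.norm_real,
    Real.norm_eq_abs]
  push_cast
  linarith

theorem one_mem_littleBlochSpace : (fun _ => 1 : Cn n → ℂ) ∈ littleBlochSpace n := by
  have h : ∀ z : Cn n, Q (fun _ => 1 : Cn n → ℂ) z = 0 := fun z => by simp [Q]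
  refine ⟨mem_blochSpace (differentiableOn_const _) fun z _ => (h z).le, ?_⟩
  exact tendsto_const_nhds.congr fun z => (h z).symm

/-! ### Necessity of condition (c). -/

/-- Iterating `M_ψ` on the constant function `1` shows that a multiplier is bounded. -/
theorem MulOpBoundedOn.exists_norm_le {ψ : Cn n → ℂ} {X : Set (Cn n → ℂ)}
    (hX : X ⊆ blochSpace n) (h1 : (fun _ => 1) ∈ X) (h : MulOpBoundedOn ψ X) :
    ∃ C, ∀ z ∈ unitBall n, ‖ψ z‖ ≤ C := by
  obtain ⟨hmap, C, hC⟩ := h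
  have hpow : ∀ k : ℕ, (fun z => ψ z ^ k) ∈ X ∧ blochNorm (fun z => ψ z ^ k) ≤
      (max C 1) ^ k * blochNorm (fun _ : Cn n => (1 : ℂ)) := by
    intro k
    induction k with
    | zero => simpa using h1
    | succ k ih =>
      have e : (fun z => ψ z ^ (k + 1)) = mulOp ψ fun z => ψ z ^ k := by
        funext z
        rw [mulOp, pow_succ']
      rw [e]
      refine ⟨hmap _ ih.1, (hC _ ih.1).trans ?_⟩
      rw [pow_succ', mul_assoc]
      exact mul_le_mul (le_max_left _ _) ih.2 (blochNorm_nonneg _) (by positivity)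
  refine ⟨max C 1, fun z hz => ?_⟩
  by_contra! hlt
  have hm : 0 < max C 1 := by positivity
  -- At a fixed `z` the growth bound gives `‖ψ z‖ ^ k ≤ const * (max C 1) ^ k` for all `k`, which
  -- fails for large `k` if `‖ψ z‖ > max C 1`.
  obtain ⟨k, hk⟩ := pow_unbounded_of_one_lt
    ((1 + logRatio ‖z‖) * blochNorm (fun _ : Cn n => (1 : ℂ))) ((one_lt_div hm).2 hlt)
  have h2 := norm_le_blochNorm_mul (hX (hpow k).1) hz
  have hL := logRatio_nonneg (norm_nonneg z) (mem_unitBall.1 hz)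
  have h3 := h2.trans (mul_le_mul_of_nonneg_left (hpow k).2 (by linarith))
  rw [div_pow, lt_div_iff₀ (by positivity)] at hk
  rw [norm_pow] at h3
  linarith

/-- Allowing any `X` between the two spaces treats (a) and (b) at once, since all test functions are
little Bloch. -/
theorem MulOpBoundedOn.exists_logRatio_mul_Q_le {ψ : Cn n → ℂ} (hψ : IsHolo ψ)
    {X : Set (Cn n → ℂ)} (hX : X ⊆ blochSpace n) (hlX : littleBlochSpace n ⊆ X)
    (h : MulOpBoundedOn ψ X) : IsHInfty ψ ∧ ∃ K, ∀ z ∈ unitBall n, logRatio ‖z‖ * Q ψ z ≤ K := by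
  obtain ⟨A, hA⟩ := h.exists_norm_le hX (hlX one_mem_littleBlochSpace)
  refine ⟨⟨hψ, A, hA⟩, ?_⟩
  obtain ⟨hmap, C, hC⟩ := h
  have hψX : ψ ∈ blochSpace n := by
    have := hX (hmap _ (hlX one_mem_littleBlochSpace))
    have e : mulOp ψ (fun _ => 1) = ψ := by
      funext z
      simp [mulOp]
    rwa [e] at this
  -- The test function with parameter `z` is evaluated at `z` itself. The terms come from the
  -- additive loss `2 * log 2`, the bound on `M_ψ` and the bound on `ψ`; each `4` bounds the test
  -- function. The sign of `C` is not known, hence `|C|`.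
  refine ⟨2 * Real.log 2 * blochSeminorm ψ + (|C| * 4 + A * 4), fun z hz => ?_⟩
  have hf := hlX (logKernel_mem_littleBlochSpace hz)
  have hA0 : 0 ≤ A := (norm_nonneg _).trans (hA z hz)
  have h1 := norm_mul_Q_le hψ (hX hf).1 hz
  have h2 : Q (mulOp ψ (logKernel z)) z ≤ |C| * 4 := by
    refine (Q_le_blochSeminorm (hX (hmap _ hf)) hz).trans
      ((blochSeminorm_le_blochNorm _).trans ((hC _ hf).trans ?_))
    exact mul_le_mul (le_abs_self C) (blochNorm_logKernel_le hz) (blochNorm_nonneg _)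
      (abs_nonneg C)
  have h3 : ‖ψ z‖ * Q (logKernel z) z ≤ A * 4 :=
    mul_le_mul (hA z hz) (Q_logKernel_le hz hz) (Q_nonneg _ _) hA0
  have h4 := mul_le_mul_of_nonneg_right (logRatio_le_norm_logKernel hz) (Q_nonneg ψ z)
  have h5 : 2 * Real.log 2 * Q ψ z ≤ 2 * Real.log 2 * blochSeminorm ψ :=
    mul_le_mul_of_nonneg_left (Q_le_blochSeminorm hψX hz) (by positivity)
  linarith

end BlochBall

theorem mainTheorem7 (n : ℕ) (ψ : BlochBall.Cn n → ℂ) (hψ : BlochBall.IsHolo ψ) :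
    List.TFAE [
      BlochBall.MulOpBoundedOn ψ (BlochBall.blochSpace n),
      BlochBall.MulOpBoundedOn ψ (BlochBall.littleBlochSpace n),
      BlochBall.IsHInfty ψ ∧
        BddAbove (Set.range fun z : BlochBall.unitBall n =>
          Real.log ((1 + ‖(z : BlochBall.Cn n)‖) / (1 - ‖(z : BlochBall.Cn n)‖)) *
            BlochBall.Q ψ z)] := by
  have hlittle : BlochBall.littleBlochSpace n ⊆ BlochBall.blochSpace n := fun _ hf => hf.1
  have hbdd : BddAbove (Set.range fun z : BlochBall.unitBall n =>
      Real.log ((1 + ‖(z : BlochBall.Cn n)‖) / (1 - ‖(z : BlochBall.Cn n)‖)) *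
        BlochBall.Q ψ z) ↔
      ∃ K, ∀ z ∈ BlochBall.unitBall n, BlochBall.logRatio ‖z‖ * BlochBall.Q ψ z ≤ K := by
    simp only [bddAbove_def, Set.forall_mem_range, Subtype.forall, BlochBall.logRatio]
  rw [hbdd]
  tfae_have 1 → 3 := fun h => h.exists_logRatio_mul_Q_le hψ subset_rfl hlittle
  tfae_have 2 → 3 := fun h => h.exists_logRatio_mul_Q_le hψ hlittle subset_rfl
  tfae_have 3 → 1 := by
    rintro ⟨hb, K, hK⟩
    obtain ⟨C, hC⟩ := BlochBall.exists_mulOp_bound hb hK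
    exact ⟨fun f hf => (hC f hf).1, C, fun f hf => (hC f hf).2⟩
  tfae_have 3 → 2 := by
    rintro ⟨hb, K, hK⟩
    obtain ⟨C, hC⟩ := BlochBall.exists_mulOp_bound hb hK
    exact ⟨fun f hf => BlochBall.mulOp_mem_littleBlochSpace hb hK hf, C,
      fun f hf => (hC f hf.1).2⟩
  tfae_finish
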